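/- Let $\mathcal X$ be a Polish space with its Borel $\sigma$-algebra. Concepts are functions $h:\mathcal X\to\{0,1\}$. For $S\in\mathcal X^m$ put $\widehat L_S(h,c)=\frac1m\sum_{i=1}^m\mathbf 1[h(S_i)\ne c(S_i)]$ (and $0$ if $m=0$), and for $p=(S,T)\in\mathcal X^m\times\mathcal X^m$ put $\Gamma^c_h(p)=\widehat L_T(h,c)-\widehat L_S(h,c)$. For a class $\mathcal C$ of concepts let $E_{\mathcal C,c,m,\varepsilon}=\{p:\exists h\in\mathcal C,\ \Gamma^c_h(p)\ge\varepsilon/2\}$ and $G_{\mathcal C,c,m}(p)=\sup_{h\in\mathcal C}\Gamma^c_h(p)$ (with $\sup\emptyset=0$). Say that $\mathrm{WB}_{\mathrm{meas}}(\mathcal C)$ holds if $E_{\mathcal C,c,m,\varepsilon}$ is measurable in the completion of $\mu^{2m}$ for every Borel probability measure $\mu$ on $\mathcal X$, every measurable target $c$, every $m\in\mathbb N$ and every $\varepsilon>0$; that $\mathrm{KW}(\mathcal C)$ holds if $G_{\mathcal C,c,m}$ is Borel measurable for every target $c$ and every $m$; and that $\mathrm{KW}_{\mathrm{meas}}(\mathcal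 C)$ holds if this is so for every measurable target $c$ and every $m$. Below, $\mu^m$ and $\mu^{2m}$ of a possibly non-measurable set denote outer measure. (1) Let $\mathcal C$ be a class of measurable concepts with $\operatorname{VCdim}(\mathcal C)\le d<\infty$ that satisfies $\mathrm{WB}_{\mathrm{meas}}(\mathcal C)$. Then for every Borel probability measure $\mu$, every target $c\in\mathcal C$, every $m$ and every $\varepsilon>0$: if $m\varepsilon\ge 8$ then $$\mu^m\{S:\exists h\in\mathcal C,\ \widehat L_S(h,c)=0,\ \mu\{h\ne c\}\ge\varepsilon\}\le 2\,\mu^{2m}(E_{\mathcal C,c,m,\varepsilon});$$ and, for all $m$, the event $E_{\mathcal C,c,m,\varepsilon}$ is measurable in the completion of $\mu^{2m}$, with $$\mu^{2m}(E_{\mathcal C,c,m,\varepsilon})\le\sum_{i=0}^d\binom{2m}{i}\,e^{-m\varepsilon^2/8}.$$ Moreover every learner that, on each sample labelled by a target in $\mathcal C$, outputs a concept of $\mathcal C$ agreeing with the target on the sample is a realizable PAC learner for $\mathcal C$: for all $\varepsilon,\delta>0$ there is $N$ such that for all $m\ge N$, all $\mu$ and all $c\in\mathcal C$, the output on an i.i.d.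 sample from $\mu$ of size $m$ labelled by $c$ has error greater than $\varepsilon$ with probability at most $\delta$. In particular $\mathcal C$ is PAC learnable in the realizable setting, by a learner with measurable outputs. (2) The Borel condition is stronger: for every class $\mathcal C$ of concepts on $\mathcal X$, $\mathrm{KW}(\mathcal C)\Rightarrow\mathrm{KW}_{\mathrm{meas}}(\mathcal C)\Rightarrow\mathrm{WB}_{\mathrm{meas}}(\mathcal C)$. It is strictly stronger: there is a class $\mathcal C$ of measurable concepts on $\mathbb R$ of finite VC dimension that satisfies $\mathrm{WB}_{\mathrm{meas}}(\mathcal C)$ but not $\mathrm{KW}_{\mathrm{meas}}(\mathcal C)$, and hence not $\mathrm{KW}(\mathcal C)$. (3) Call a class Borel-parameterized if it is $\{e(\theta,\cdot):\theta\in\Theta\}$ for a standard Borel space $\Theta$ and a jointly measurable $e:\Theta\times\mathcal X\to\{0,1\}$. Every Borel-parameterized class, and every class obtained from such classes by finitely many applications of the following operations, consists of measurable concepts and satisfies $\mathrm{WB}_{\mathrm{meas}}$: (a) patching: from $\mathcal C_1,\mathcal C_2,\mathcal R$ form the class of all functions equal to $h_1$ on $\{r=1\}$ and to $h_2$ on $\{r=0\}$,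 with $h_i\in\mathcal C_i$ and $r\in\mathcal R$; (b) fixed interpolation: for a measurable set $A$, the class of all functions equal to $h_1$ on $A$ and to $h_2$ on $A^c$, with $h_i\in\mathcal C_i$; (c) countable interpolation: for measurable sets $(A_n)_{n\in\mathbb N}$, the union over $n$ of the fixed interpolations along $A_n$; (d) fiber-product amalgamation: for standard Borel spaces $\Theta_1,\Theta_2,S$, measurable maps $\pi_i:\Theta_i\to S$ and a jointly measurable $e:\Theta_1\times\Theta_2\times\mathcal X\to\{0,1\}$, the class $\{e(\theta_1,\theta_2,\cdot):\pi_1(\theta_1)=\pi_2(\theta_2)\}$. -/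

import Mathlib

open MeasureTheory

universe u w

namespace GhostGap

noncomputable section

/-! ### Concepts, empirical errors, the one-sided ghost gap -/

/-- A binary concept on `X`; the labels `0, 1` are `false, true`. -/
abbrev Concept (X : Type u) := X → Bool

/-- Empirical zero-one error of `h` against the target `c` on the sample `S`
(it is `0` on the empty sample). -/
def empErr {X : Type u} {m : ℕ} (h c : Concept X) (S : Fin m → X) : ℝ :=
  (∑ i, if h (S i) ≠ c (S i) then (1 : ℝ) else 0) / m

/-- One-sided ghost gap of `h`: error on the ghost sample minus error on the training sample. -/
def gap {X : Type u} {m : ℕ} (h c : Concept X) (p : (Fin m → X) × (Fin m → X)) : ℝ :=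
  empErr h c p.2 - empErr h c p.1

/-- The one-sided bad event. -/
def badEvent {X : Type u} (C : Set (Concept X)) (c : Concept X) (m : ℕ) (ε : ℝ) :
    Set ((Fin m → X) × (Fin m → X)) :=
  {p | ∃ h ∈ C, ε / 2 ≤ gap h c p}

/-- The supremum of the one-sided ghost gap over the class. For a nonempty class it ranges over a
nonempty finite set of reals, so it is a maximum. -/
def supGap {X : Type u} (C : Set (Concept X)) (c : Concept X) (m : ℕ)
    (p : (Fin m → X) × (Fin m → X)) : ℝ :=
  ⨆ h : C, gap h.1 c p

section Measurability

variable {X : Type u} [MeasurableSpace X]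

/-- The law `μ ^ m` of an i.i.d. sample of size `m`. -/
def sampleLaw (μ : Measure X) (m : ℕ) : Measure (Fin m → X) :=
  Measure.pi fun _ => μ

/-- The law `μ ^ (2 m)` of a training sample together with an independent ghost sample. -/
def doubleLaw (μ : Measure X) (m : ℕ) : Measure ((Fin m → X) × (Fin m → X)) :=
  (sampleLaw μ m).prod (sampleLaw μ m)

/-- Event-level measurability for measurable targets: every bad event is measurable in the
completion of the double-sample law. -/
def WBMeas (C : Set (Concept X)) : Prop :=
  ∀ (μ : Measure X) [IsProbabilityMeasure μ] (c : Concept X), Measurable c →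
    ∀ (m : ℕ) (ε : ℝ), 0 < ε → NullMeasurableSet (badEvent C c m ε) (doubleLaw μ m)

/-- The Borel ghost-gap condition, over all targets. -/
def KW (C : Set (Concept X)) : Prop :=
  ∀ (c : Concept X) (m : ℕ), Measurable (supGap C c m)

/-- The Borel ghost-gap condition, over measurable targets only. -/
def KWMeas (C : Set (Concept X)) : Prop :=
  ∀ c : Concept X, Measurable c → ∀ m : ℕ, Measurable (supGap C c m)

end Measurability

/-! ### VC dimension -/

/-- `C` realizes every 0-1 labelling of the finite set `s`. -/
def Shatters {X : Type u} (C : Set (Concept X)) (s : Finset X) : Prop :=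
  ∀ t ⊆ s, ∃ h ∈ C, ∀ x ∈ s, (h x = true ↔ x ∈ t)

/-- VC dimension, with value `⊤` if arbitrarily large finite sets are shattered. -/
def vcDim {X : Type u} (C : Set (Concept X)) : ℕ∞ :=
  ⨆ (s : Finset X) (_ : Shatters C s), (s.card : ℕ∞)

/-! ### Realizable PAC learning -/

/-- A learner maps finite labelled samples, of any size, to concepts. -/
abbrev Learner (X : Type u) := ∀ m : ℕ, (Fin m → X × Bool) → Concept X

/-- The sample `S` labelled by the target `c`. -/
def labelled {X : Type u} {m : ℕ} (c : Concept X) (S : Fin m → X) : Fin m → X × Bool :=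
  fun i => (S i, c (S i))

/-- On every sample labelled by a target in `C`, the learner outputs a concept of `C` that agrees
with the target on the sample. -/
def IsConsistentLearner {X : Type u} (C : Set (Concept X)) (A : Learner X) : Prop :=
  ∀ c ∈ C, ∀ (m : ℕ) (S : Fin m → X),
    A m (labelled c S) ∈ C ∧ ∀ i, A m (labelled c S) (S i) = c (S i)

section PAC

variable {X : Type u} [MeasurableSpace X]

/-- The true zero-one error of `h` against `c` under `μ`. -/
def trueErr (μ : Measure X) (h c : Concept X) : ENNReal := μ {x | h x ≠ c x}

/-- `A` is a PAC learner for `C` in the realizable setting, with a sample size `N ε δ` that works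
for all distributions and all targets in `C`. A measure evaluated at an arbitrary set is the outer
measure of that set, so no measurability of the learner is presupposed. -/
def IsPACLearner (C : Set (Concept X)) (A : Learner X) : Prop :=
  ∃ N : ℝ → ℝ → ℕ, ∀ ε δ : ℝ, 0 < ε → 0 < δ → ∀ m : ℕ, N ε δ ≤ m →
    ∀ (μ : Measure X) [IsProbabilityMeasure μ], ∀ c ∈ C,
      sampleLaw μ m {S | ENNReal.ofReal ε < trueErr μ (A m (labelled c S)) c} ≤ ENNReal.ofReal δ

/-- Realizable PAC learnability, by a learner with measurable outputs. -/
def PACLearnable (C : Set (Concept X)) : Prop :=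
  ∃ A : Learner X, (∀ m S, Measurable (A m S)) ∧ IsPACLearner C A

end PAC

/-! ### Borel-parameterized classes and the constructors -/

/-- The class of all patchings of a concept of `C₁` and a concept of `C₂` along a router in `R`.
For `C₁ = {e₁(θ₁, ·)}`, `C₂ = {e₂(θ₂, ·)}` and `R = {r(ρ, ·)}` it is `Patch(e₁, e₂, r)`. -/
def patchClass {X : Type u} (C₁ C₂ R : Set (Concept X)) : Set (Concept X) :=
  {h | ∃ h₁ ∈ C₁, ∃ h₂ ∈ C₂, ∃ r ∈ R, h = fun x => if r x = true then h₁ x else h₂ x}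

/-- Fixed-region interpolation: a concept of `C₁` on `A` and a concept of `C₂` off `A`. -/
def interpClass {X : Type u} (A : Set X) (C₁ C₂ : Set (Concept X)) : Set (Concept X) :=
  {h | ∃ h₁ ∈ C₁, ∃ h₂ ∈ C₂, (∀ x ∈ A, h x = h₁ x) ∧ ∀ x ∉ A, h x = h₂ x}

/-- Countable-router interpolation: the region may be any one of the `A n`. -/
def countableInterpClass {X : Type u} (A : ℕ → Set X) (C₁ C₂ : Set (Concept X)) :
    Set (Concept X) :=
  ⋃ n, interpClass (A n) C₁ C₂

/-- Fiber-product amalgamation of two parameter spaces over `S` with merge map `e`. -/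
def amalClass {X : Type u} {Θ₁ Θ₂ S : Type w} (π₁ : Θ₁ → S) (π₂ : Θ₂ → S)
    (e : Θ₁ → Θ₂ → Concept X) : Set (Concept X) :=
  {h | ∃ θ₁ θ₂, π₁ θ₁ = π₂ θ₂ ∧ h = e θ₁ θ₂}

/-- The classes obtained from Borel-parameterized ones by finitely many (possibly zero) patchings,
fixed or countable interpolations and fiber-product amalgamations. -/
inductive BorelGenerated {X : Type u} [MeasurableSpace X] : Set (Concept X) → Prop
  /-- The class of a jointly measurable evaluator over a standard Borel parameter space. -/
  | param {Θ : Type w} [MeasurableSpace Θ] [StandardBorelSpace Θ] (e : Θ → Concept X)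
      (he : Measurable fun q : Θ × X => e q.1 q.2) : BorelGenerated (Set.range e)
  | patch {C₁ C₂ R : Set (Concept X)} (h₁ : BorelGenerated C₁) (h₂ : BorelGenerated C₂)
      (hR : BorelGenerated R) : BorelGenerated (patchClass C₁ C₂ R)
  | interp {A : Set X} (hA : MeasurableSet A) {C₁ C₂ : Set (Concept X)}
      (h₁ : BorelGenerated C₁) (h₂ : BorelGenerated C₂) : BorelGenerated (interpClass A C₁ C₂)
  | countableInterp {A : ℕ → Set X} (hA : ∀ n, MeasurableSet (A n)) {C₁ C₂ : Set (Concept X)}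
      (h₁ : BorelGenerated C₁) (h₂ : BorelGenerated C₂) :
      BorelGenerated (countableInterpClass A C₁ C₂)
  | amal {Θ₁ Θ₂ S : Type w} [MeasurableSpace Θ₁] [StandardBorelSpace Θ₁]
      [MeasurableSpace Θ₂] [StandardBorelSpace Θ₂] [MeasurableSpace S] [StandardBorelSpace S]
      (π₁ : Θ₁ → S) (π₂ : Θ₂ → S) (hπ₁ : Measurable π₁) (hπ₂ : Measurable π₂)
      (e : Θ₁ → Θ₂ → Concept X)
      (he : Measurable fun q : (Θ₁ × Θ₂) × X => e q.1.1 q.1.2 q.2) :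
      BorelGenerated (amalClass π₁ π₂ e)

end

end GhostGap

/-!
The route to PAC learning is the classical double-sample argument, run under measurability of the
bad event in the completion only.

*Symmetrization* (`sampleLaw_exists_consistent_le`). If some consistent concept `h` has true error
at least `ε`, then with probability at least `1 / 2` the ghost sample shows an error of `h` of at
least `ε / 2` (Chernoff, `half_le_sampleLaw_le_empErr`). Integrating over the training sample gives
the factor `2`; a measurable hull of the bad event replaces it in Fubini's theorem.

*The VC bound* (`doubleLaw_badEvent_le`). The double law is invariant under exchanging training and
ghost points coordinatewise. For a fixed double sample, the gap of `h` after a random exchange is a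
Rademacher sum that depends on the trace of `h` only, so Sauer-Shelah and Hoeffding bound the number
of exchanges leading into the bad event. Averaging over exchanges is where null-measurability of
the bad event is used. Both bounds together control every consistent learner.

*The Borel condition is strictly stronger.* For a nonempty class the gap takes finitely many values
at each double sample, so its supremum is attained and the bad event is a superlevel set of it.
The separating class (`exists_wbMeas_not_kwMeas`) consists of the unit intervals `[a, a + 1]` with
`a` in `A = B ∪ ℚ`, where `B ⊆ [-1, 0)` is any non-Borel set. An interval can be replaced by a
rational one with the same trace on a finite set of points, unless two of these points are exactly
`a` and `a + 1`. Under a product measure this happens with positive probability only if `a` is an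
atom, so countably many intervals give the bad event up to a null set. But on the null line of
pairs `(t + 1, t)`, with target `[0, ∞)`, the bad event is precisely `t ∈ A`.

*Borel-generated classes.* Patching, interpolation and fiber-product amalgamation of
Borel-parameterized classes are again Borel-parameterized (`BorelGenerated.isBorelParam`), by
products and Borel subsets of standard Borel spaces. The bad event of such a class is the projection
of a Borel set, hence analytic, and analytic sets are universally measurable
(`AnalyticSet.nullMeasurableSet_of_outerRegular`): images of compact boxes of Baire space
exhaust their measure.
-/

/-! ### Analytic sets are universally measurable -/

/-- If the first `k` coordinates of the points of a set are bounded, bounding the next one as well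
costs arbitrarily little outer measure of the image. -/
theorem exists_measure_image_le_image_inter_add {α : Type*} [MeasurableSpace α] (μ : Measure α)
    [IsFiniteMeasure μ] (f : (ℕ → ℕ) → α) (B : Set (ℕ → ℕ)) (k : ℕ) {δ : ENNReal} (hδ : δ ≠ 0) :
    ∃ N : ℕ, μ (f '' B) ≤ μ (f '' (B ∩ {x | x k ≤ N})) + δ := by
  have hmono : Monotone fun N : ℕ => f '' (B ∩ {x | x k ≤ N}) := fun a b hab =>
    Set.image_mono (Set.inter_subset_inter_right _ fun x (hx : x k ≤ a) => hx.trans hab)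
  have hU : f '' B = ⋃ N : ℕ, f '' (B ∩ {x | x k ≤ N}) := by
    rw [← Set.image_iUnion, ← Set.inter_iUnion,
      Set.iUnion_eq_univ_iff.2 fun x => ⟨x k, le_refl (x k)⟩,
      Set.inter_univ]
  rcases eq_or_ne (μ (f '' B)) 0 with h0 | h0
  · exact ⟨0, by simp [h0]⟩
  have hlt : μ (f '' B) - δ < ⨆ N : ℕ, μ (f '' (B ∩ {x | x k ≤ N})) := by
    rw [← hmono.measure_iUnion, ← hU]
    exact ENNReal.sub_lt_self (measure_ne_top _ _) h0 hδ
  obtain ⟨N, hN⟩ := lt_iSup_iff.1 hlt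
  exact ⟨N, tsub_le_iff_right.1 hN.le⟩

theorem isCompact_setOf_forall_le (n : ℕ → ℕ) : IsCompact {x : ℕ → ℕ | ∀ i, x i ≤ n i} := by
  have := isCompact_univ_pi fun i => (Set.finite_Iic (n i)).isCompact
  simpa [Set.pi] using this

/-- An open set of sequences containing a box `∏ k, [0, n k]` contains all the sequences that
satisfy finitely many of the constraints of the box. -/
theorem exists_forall_lt_le_subset_of_isOpen (n : ℕ → ℕ) {V : Set (ℕ → ℕ)} (hV : IsOpen V)
    (h : {x | ∀ i, x i ≤ n i} ⊆ V) : ∃ k, {x : ℕ → ℕ | ∀ i < k, x i ≤ n i} ⊆ V := by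
  by_contra! hcon
  choose x hx hxV using fun k => Set.not_subset.1 (hcon k)
  obtain ⟨y, hyK, φ, hφ, hy⟩ := (isCompact_setOf_forall_le n).tendsto_subseq
    (x := fun k i => min (x k i) (n i)) fun k i => min_le_right _ _
  -- the sequence agrees with its truncation on longer and longer initial segments
  have hx' : Filter.Tendsto (x ∘ φ) Filter.atTop (nhds y) := by
    rw [tendsto_pi_nhds] at hy ⊢
    intro i
    refine (hy i).congr' ?_
    filter_upwards [Filter.eventually_gt_atTop i] with k hk
    exact min_eq_left (hx (φ k) i (hk.trans_le (hφ.id_le k)))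
  obtain ⟨k, hk⟩ := (hx'.eventually (hV.mem_nhds (h hyK))).exists
  exact hxV _ hk

/-- The range of a continuous map on Baire space contains compact sets of almost full measure. -/
theorem exists_isCompact_subset_range_measure_le {α : Type*} [TopologicalSpace α]
    [MeasurableSpace α] (μ : Measure α) [IsFiniteMeasure μ] [μ.OuterRegular]
    {f : (ℕ → ℕ) → α} (hf : Continuous f) {ε : ENNReal} (hε : ε ≠ 0) :
    ∃ K ⊆ Set.range f, IsCompact K ∧ μ (Set.range f) ≤ μ K + ε := by
  obtain ⟨δ, hδ, hδε⟩ := ENNReal.exists_pos_sum_of_countable' hε ℕ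
  choose N hN using fun (B : Set (ℕ → ℕ)) (k : ℕ) =>
    exists_measure_image_le_image_inter_add μ f B k (hδ k).ne'
  -- bound the coordinates one after the other, the `k`-th one at the cost of `δ k`
  let B : ℕ → Set (ℕ → ℕ) := fun k => Nat.rec Set.univ (fun k B => B ∩ {x | x k ≤ N B k}) k
  have hB : ∀ k, B (k + 1) = B k ∩ {x | x k ≤ N (B k) k} := fun k => rfl
  let n : ℕ → ℕ := fun k => N (B k) k
  have hBn : ∀ k, B k = {x | ∀ i < k, x i ≤ n i} := by
    intro k
    induction k with
    | zero => ext; simp [B]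
    | succ k ih =>
      ext x
      have hx : x ∈ B k ↔ ∀ i < k, x i ≤ n i := by rw [ih]; rfl
      rw [hB, Set.mem_inter_iff, hx]
      exact Nat.forall_lt_succ_right.symm
  have hmeas : ∀ k, μ (Set.range f) ≤ μ (f '' B k) + ∑ i ∈ Finset.range k, δ i := by
    intro k
    induction k with
    | zero => simp [B]
    | succ k ih =>
      refine ih.trans ?_
      rw [Finset.sum_range_succ, add_comm (∑ i ∈ _, _), ← add_assoc, hB]
      exact add_le_add_left (hN _ _) _
  refine ⟨f '' {x | ∀ i, x i ≤ n i}, Set.image_subset_range _ _,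
    (isCompact_setOf_forall_le n).image hf, ?_⟩
  refine tsub_le_iff_right.1 ?_
  -- an open set around the image of the box contains the image of some `B k`
  rw [Set.measure_eq_iInf_isOpen (f '' _) μ]
  refine le_iInf₂ fun U hKU => le_iInf fun hU => ?_
  obtain ⟨k, hk⟩ := exists_forall_lt_le_subset_of_isOpen n (hU.preimage hf)
    (Set.image_subset_iff.1 hKU)
  rw [← hBn] at hk
  refine tsub_le_iff_right.2 ((hmeas k).trans (add_le_add ?_ ?_))
  · exact measure_mono (Set.image_subset_iff.2 hk)
  · exact (ENNReal.sum_le_tsum _).trans hδε.le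

/-- Analytic sets are universally measurable. -/
theorem MeasureTheory.AnalyticSet.nullMeasurableSet_of_outerRegular {α : Type*}
    [TopologicalSpace α] [T2Space α] [MeasurableSpace α] [BorelSpace α] {s : Set α}
    (hs : AnalyticSet s) (μ : Measure α)
    [IsFiniteMeasure μ] [μ.OuterRegular] : NullMeasurableSet s μ := by
  rw [AnalyticSet] at hs
  obtain rfl | ⟨f, hf, rfl⟩ := hs
  · exact nullMeasurableSet_empty
  choose K hKs hK hμK using fun j : ℕ => exists_isCompact_subset_range_measure_le μ hf
    (ε := ((j : ENNReal) + 1)⁻¹) (by simp)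
  have hm : MeasurableSet (⋃ j, K j) := .iUnion fun j => (hK j).measurableSet
  refine hm.nullMeasurableSet.congr (ae_eq_of_subset_of_measure_ge (Set.iUnion_subset hKs) ?_
    hm.nullMeasurableSet (measure_ne_top _ _))
  refine ENNReal.le_of_forall_pos_le_add fun ε hε _ => ?_
  obtain ⟨j, hj⟩ := ENNReal.exists_inv_nat_lt (a := (ε : ENNReal)) (by simpa using hε.ne')
  refine (hμK j).trans (add_le_add (measure_mono (Set.subset_iUnion K j)) (le_trans ?_ hj.le))
  exact ENNReal.inv_le_inv.2 le_self_add

namespace GhostGap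

/-! ### Borel-generated classes are Borel-parameterized -/

section Param

variable {X : Type u} [MeasurableSpace X]

theorem measurable_empErr {Θ : Type*} [MeasurableSpace Θ] {m : ℕ} {e : Θ → Concept X}
    (he : Measurable fun q : Θ × X => e q.1 q.2) {c : Concept X} (hc : Measurable c) :
    Measurable fun q : Θ × (Fin m → X) => empErr (e q.1) c q.2 := by
  unfold empErr
  refine (Finset.measurable_sum _ fun i _ => ?_).div_const _
  refine Measurable.ite (MeasurableSet.compl ?_) measurable_const measurable_const
  have hi : Measurable fun q : Θ × (Fin m → X) => q.2 i :=
    (measurable_pi_apply i).comp measurable_snd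
  exact measurableSet_eq_fun (he.comp (measurable_fst.prodMk hi)) (hc.comp hi)

theorem measurable_gap_param {Θ : Type*} [MeasurableSpace Θ] {m : ℕ} {e : Θ → Concept X}
    (he : Measurable fun q : Θ × X => e q.1 q.2) {c : Concept X} (hc : Measurable c) :
    Measurable fun q : Θ × ((Fin m → X) × (Fin m → X)) => gap (e q.1) c q.2 := by
  have hT := (measurable_empErr (m := m) he hc).comp
    (g := fun q : Θ × (Fin m → X) => empErr (e q.1) c q.2)
    (f := fun q : Θ × ((Fin m → X) × (Fin m → X)) => (q.1, q.2.2)) (by fun_prop)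
  have hS := (measurable_empErr (m := m) he hc).comp
    (g := fun q : Θ × (Fin m → X) => empErr (e q.1) c q.2)
    (f := fun q : Θ × ((Fin m → X) × (Fin m → X)) => (q.1, q.2.1)) (by fun_prop)
  exact hT.sub hS

theorem measurable_gap {m : ℕ} {h c : Concept X} (hh : Measurable h) (hc : Measurable c) :
    Measurable (gap (m := m) h c) := by
  have H := measurable_gap_param (Θ := Unit) (m := m) (e := fun _ => h) (hh.comp measurable_snd) hc
  exact H.comp (g := fun q : Unit × ((Fin m → X) × (Fin m → X)) => gap h c q.2)
    (f := fun p : (Fin m → X) × (Fin m → X) => ((), p)) (by fun_prop)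

/-- The class is the set of sections of a jointly measurable evaluator over a standard Borel
parameter space. -/
def IsBorelParam (C : Set (Concept X)) : Prop :=
  ∃ (Θ : Type w) (_ : MeasurableSpace Θ) (_ : StandardBorelSpace Θ) (e : Θ → Concept X),
    (Measurable fun q : Θ × X => e q.1 q.2) ∧ C = Set.range e

theorem IsBorelParam.measurable {C : Set (Concept X)} (hC : IsBorelParam.{u, w} C) :
    ∀ h ∈ C, Measurable h := by
  obtain ⟨Θ, _, _, e, he, rfl⟩ := hC
  rintro _ ⟨θ, rfl⟩
  exact he.comp measurable_prodMk_left

/-- The bad event of a Borel-parameterized class is the projection of a Borel set, hence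
analytic. -/
theorem IsBorelParam.wbMeas [TopologicalSpace X] [PolishSpace X] [BorelSpace X]
    {C : Set (Concept X)} (hC : IsBorelParam.{u, w} C) : WBMeas C := by
  obtain ⟨Θ, _, _, e, he, rfl⟩ := hC
  intro μ _ c hc m ε _
  have hM : MeasurableSet {q : Θ × ((Fin m → X) × (Fin m → X)) | ε / 2 ≤ gap (e q.1) c q.2} :=
    measurableSet_le measurable_const (measurable_gap_param he hc)
  have hE : badEvent (Set.range e) c m ε = Prod.snd ''
      {q : Θ × ((Fin m → X) × (Fin m → X)) | ε / 2 ≤ gap (e q.1) c q.2} := by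
    ext p
    simp [badEvent]
  have : IsFiniteMeasure (doubleLaw μ m) := by
    unfold doubleLaw sampleLaw
    infer_instance
  rw [hE]
  exact (hM.analyticSet_image measurable_snd).nullMeasurableSet_of_outerRegular _

theorem IsBorelParam.patch {C₁ C₂ R : Set (Concept X)} (h₁ : IsBorelParam.{u, w} C₁)
    (h₂ : IsBorelParam.{u, w} C₂) (hR : IsBorelParam.{u, w} R) :
    IsBorelParam.{u, w} (patchClass C₁ C₂ R) := by
  obtain ⟨Θ₁, _, _, e₁, he₁, rfl⟩ := h₁
  obtain ⟨Θ₂, _, _, e₂, he₂, rfl⟩ := h₂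
  obtain ⟨P, _, _, r, hr, rfl⟩ := hR
  refine ⟨Θ₁ × Θ₂ × P, inferInstance, inferInstance,
    fun θ x => if r θ.2.2 x = true then e₁ θ.1 x else e₂ θ.2.1 x, ?_, ?_⟩
  · refine Measurable.ite (measurableSet_eq_fun ?_ measurable_const) ?_ ?_
    · exact hr.comp (f := fun q : (Θ₁ × Θ₂ × P) × X => (q.1.2.2, q.2)) (by fun_prop)
    · exact he₁.comp (f := fun q : (Θ₁ × Θ₂ × P) × X => (q.1.1, q.2)) (by fun_prop)
    · exact he₂.comp (f := fun q : (Θ₁ × Θ₂ × P) × X => (q.1.2.1, q.2)) (by fun_prop)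
  · ext h
    constructor
    · rintro ⟨_, ⟨θ₁, rfl⟩, _, ⟨θ₂, rfl⟩, _, ⟨ρ, rfl⟩, rfl⟩
      exact ⟨(θ₁, θ₂, ρ), rfl⟩
    · rintro ⟨θ, rfl⟩
      exact ⟨_, ⟨θ.1, rfl⟩, _, ⟨θ.2.1, rfl⟩, _, ⟨θ.2.2, rfl⟩, rfl⟩

/-- Interpolation along countably many regions; a one-point index type gives a fixed region. -/
theorem IsBorelParam.countableInterp {ι : Type} [Countable ι] {A : ι → Set X}
    (hA : ∀ n, MeasurableSet (A n))
    {C₁ C₂ : Set (Concept X)} (h₁ : IsBorelParam.{u, w} C₁) (h₂ : IsBorelParam.{u, w} C₂) :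
    IsBorelParam.{u, w} (⋃ n, interpClass (A n) C₁ C₂) := by
  classical
  obtain ⟨Θ₁, _, _, e₁, he₁, rfl⟩ := h₁
  obtain ⟨Θ₂, _, _, e₂, he₂, rfl⟩ := h₂
  let _ : MeasurableSpace ι := ⊤
  have : DiscreteMeasurableSpace ι := ⟨fun _ => trivial⟩
  refine ⟨ι × Θ₁ × Θ₂, inferInstance, inferInstance,
    fun θ x => if x ∈ A θ.1 then e₁ θ.2.1 x else e₂ θ.2.2 x, ?_, ?_⟩
  · refine Measurable.ite (p := fun q : (ι × Θ₁ × Θ₂) × X => q.2 ∈ A q.1.1) ?_ ?_ ?_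
    · have : {q : (ι × Θ₁ × Θ₂) × X | q.2 ∈ A q.1.1} = ⋃ n, {q | q.1.1 = n} ∩ {q | q.2 ∈ A n} := by
        ext q
        simp
      rw [this]
      refine .iUnion fun n => .inter ?_ (measurable_snd (hA n))
      exact (measurable_fst.comp measurable_fst) (measurableSet_singleton n)
    · exact he₁.comp (f := fun q : (ι × Θ₁ × Θ₂) × X => (q.1.2.1, q.2)) (by fun_prop)
    · exact he₂.comp (f := fun q : (ι × Θ₁ × Θ₂) × X => (q.1.2.2, q.2)) (by fun_prop)
  · ext h
    simp only [Set.mem_iUnion]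
    constructor
    · rintro ⟨n, _, ⟨θ₁, rfl⟩, _, ⟨θ₂, rfl⟩, h1, h2⟩
      refine ⟨(n, θ₁, θ₂), funext fun x => ?_⟩
      by_cases hx : x ∈ A n
      · simp [hx, h1 x hx]
      · simp [hx, h2 x hx]
    · rintro ⟨θ, rfl⟩
      exact ⟨θ.1, _, ⟨θ.2.1, rfl⟩, _, ⟨θ.2.2, rfl⟩, fun x hx => by simp [hx],
        fun x hx => by simp [hx]⟩

theorem IsBorelParam.amal {Θ₁ Θ₂ S : Type w} [MeasurableSpace Θ₁] [StandardBorelSpace Θ₁]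
    [MeasurableSpace Θ₂] [StandardBorelSpace Θ₂] [MeasurableSpace S] [StandardBorelSpace S]
    {π₁ : Θ₁ → S} {π₂ : Θ₂ → S} (hπ₁ : Measurable π₁) (hπ₂ : Measurable π₂)
    {e : Θ₁ → Θ₂ → Concept X} (he : Measurable fun q : (Θ₁ × Θ₂) × X => e q.1.1 q.1.2 q.2) :
    IsBorelParam.{u, w} (amalClass π₁ π₂ e) := by
  have hF : MeasurableSet {θ : Θ₁ × Θ₂ | π₁ θ.1 = π₂ θ.2} :=
    measurableSet_eq_fun (hπ₁.comp measurable_fst) (hπ₂.comp measurable_snd)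
  refine ⟨{θ : Θ₁ × Θ₂ | π₁ θ.1 = π₂ θ.2}, inferInstance, hF.standardBorel,
    fun θ => e θ.1.1 θ.1.2, ?_, ?_⟩
  · exact he.comp (measurable_subtype_coe.prodMap measurable_id)
  · ext h
    constructor
    · rintro ⟨θ₁, θ₂, hθ, rfl⟩
      exact ⟨⟨(θ₁, θ₂), hθ⟩, rfl⟩
    · rintro ⟨θ, rfl⟩
      exact ⟨_, _, θ.2, rfl⟩

theorem BorelGenerated.isBorelParam {C : Set (Concept X)} (hC : BorelGenerated.{u, w} C) :
    IsBorelParam.{u, w} C := by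
  induction hC with
  | param e he => exact ⟨_, _, inferInstance, e, he, rfl⟩
  | patch _ _ _ h₁ h₂ hR => exact h₁.patch h₂ hR
  | @interp A hA C₁ C₂ _ _ h₁ h₂ =>
    have := IsBorelParam.countableInterp (fun _ : Unit => hA) h₁ h₂
    rwa [Set.iUnion_const] at this
  | countableInterp hA _ _ h₁ h₂ => exact .countableInterp hA h₁ h₂
  | amal π₁ π₂ hπ₁ hπ₂ e he => exact .amal hπ₁ hπ₂ he

end Param

/-! ### Symmetrization -/

section Symmetrization

variable {X : Type u} [MeasurableSpace X]

instance isProbabilityMeasure_sampleLaw (μ : Measure X) [IsProbabilityMeasure μ] (m : ℕ) :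
    IsProbabilityMeasure (sampleLaw μ m) := by
  unfold sampleLaw
  infer_instance

instance isProbabilityMeasure_doubleLaw (μ : Measure X) [IsProbabilityMeasure μ] (m : ℕ) :
    IsProbabilityMeasure (doubleLaw μ m) := by
  unfold doubleLaw
  infer_instance

theorem exp_neg_sum_ite {m : ℕ} (P : Fin m → Prop) [DecidablePred P] :
    ∏ i, (if P i then Real.exp (-1) else 1) = Real.exp (-∑ i, if P i then (1 : ℝ) else 0) := by
  rw [← Finset.sum_neg_distrib, Real.exp_sum]
  refine Finset.prod_congr rfl fun i _ => ?_
  split_ifs <;> simp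

/-- Chernoff bound for the lower tail of a binomial variable, at half of its mean. -/
theorem half_le_sampleLaw_le_empErr (μ : Measure X) [IsProbabilityMeasure μ] {h c : Concept X}
    (hh : Measurable h) (hc : Measurable c) {m : ℕ} {ε : ℝ} (hε : 0 < ε) (hm : 8 ≤ m * ε)
    (herr : ENNReal.ofReal ε ≤ trueErr μ h c) :
    2⁻¹ ≤ sampleLaw μ m {T | ε / 2 ≤ empErr h c T} := by
  have hB : MeasurableSet {x | h x ≠ c x} := (measurableSet_eq_fun hh hc).compl
  have hm0 : (0 : ℝ) < m := by
    by_contra! hcon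
    nlinarith
  have hp : ε ≤ μ.real {x | h x ≠ c x} :=
    (ENNReal.ofReal_le_iff_le_toReal (measure_ne_top _ _)).1 herr
  have he : Real.exp (-1) < 0.37 := by
    have := Real.exp_one_gt_d9
    rw [Real.exp_neg, inv_lt_comm₀ (Real.exp_pos _) (by norm_num)]
    refine lt_trans ?_ this
    norm_num
  let f : X → ℝ := fun x => if h x ≠ c x then Real.exp (-1) else 1
  have hf : ∫ x, f x ∂μ = 1 - (1 - Real.exp (-1)) * μ.real {x | h x ≠ c x} := by
    have : f = fun x => 1 - {x | h x ≠ c x}.indicator (fun _ => 1 - Real.exp (-1)) x := by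
      ext x
      by_cases hx : h x = c x <;> simp [f, hx]
    rw [this, integral_sub (integrable_const _) ((integrable_const _).indicator hB),
      integral_indicator_const _ hB]
    simp [mul_comm]
  have hprod : ∫ T, ∏ i : Fin m, f (T i) ∂(sampleLaw μ m) ≤
      Real.exp (-((1 - Real.exp (-1)) * (m * ε))) := by
    rw [sampleLaw, integral_fintype_prod_eq_prod (𝕜 := ℝ) (fun _ => f), Finset.prod_const,
      Finset.card_univ, Fintype.card_fin, hf]
    have h1 : 1 - (1 - Real.exp (-1)) * μ.real {x | h x ≠ c x} ≤
        Real.exp (-((1 - Real.exp (-1)) * ε)) := by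
      have := Real.add_one_le_exp (-((1 - Real.exp (-1)) * ε))
      nlinarith
    have h0 : 0 ≤ 1 - (1 - Real.exp (-1)) * μ.real {x | h x ≠ c x} := by
      have : μ.real {x | h x ≠ c x} ≤ 1 := measureReal_le_one
      nlinarith [Real.exp_pos (-1), measureReal_nonneg (μ := μ) (s := {x | h x ≠ c x})]
    refine (pow_le_pow_left₀ h0 h1 m).trans_eq ?_
    rw [← Real.exp_nat_mul]
    ring_nf
  have hfm : Measurable f := Measurable.ite hB measurable_const measurable_const
  have hint : Integrable (fun T : Fin m → X => ∏ i, f (T i)) (sampleLaw μ m) := by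
    refine Integrable.of_bound (C := 1) ?_ (Filter.Eventually.of_forall fun T => ?_)
    · exact (Finset.measurable_prod _ fun i _ =>
        hfm.comp (measurable_pi_apply i)).aestronglyMeasurable
    · rw [Real.norm_of_nonneg (Finset.prod_nonneg fun i _ => ?_)]
      · refine Finset.prod_le_one (fun i _ => ?_) fun i _ => ?_ <;> dsimp only [f] <;> split_ifs <;>
          linarith [Real.exp_pos (-1)]
      · dsimp only [f]
        split_ifs <;> linarith [Real.exp_pos (-1)]
  have hmarkov := mul_meas_ge_le_integral_of_nonneg
    (Filter.Eventually.of_forall fun T : Fin m → X => Finset.prod_nonneg fun i _ => by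
      dsimp only [f]
      split_ifs <;> linarith [Real.exp_pos (-1)]) hint (Real.exp (-(m * ε / 2)))
  -- with `m * ε ≥ 8` the Chernoff bound is below `exp (-8 * (1 / 2 - 0.37)) < 1 / 2`
  have htail : (sampleLaw μ m).real {T | Real.exp (-(m * ε / 2)) ≤ ∏ i, f (T i)} ≤ 2⁻¹ := by
    have h1 := hmarkov.trans hprod
    have h2 : Real.exp (-((1 - Real.exp (-1)) * (m * ε))) =
        Real.exp (-(m * ε / 2)) * Real.exp (-((2⁻¹ - Real.exp (-1)) * (m * ε))) := by
      rw [← Real.exp_add]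
      ring_nf
    rw [h2] at h1
    refine (le_of_mul_le_mul_left h1 (Real.exp_pos _)).trans ?_
    have h3 : 1 ≤ (2⁻¹ - Real.exp (-1)) * (m * ε) := by nlinarith
    rw [Real.exp_neg]
    refine inv_anti₀ two_pos ?_
    linarith [Real.add_one_le_exp ((2⁻¹ - Real.exp (-1)) * (m * ε))]
  have hcompl : {T : Fin m → X | Real.exp (-(m * ε / 2)) ≤ ∏ i, f (T i)}ᶜ ⊆
      {T | ε / 2 ≤ empErr h c T} := by
    intro T hT
    simp only [Set.mem_compl_iff, Set.mem_ofPred_eq, not_le, f] at hT ⊢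
    rw [exp_neg_sum_ite (fun i => h (T i) ≠ c (T i)), Real.exp_lt_exp] at hT
    rw [empErr, le_div_iff₀ hm0]
    linarith
  refine le_trans ?_ (measure_mono hcompl)
  rw [prob_compl_eq_one_sub₀]
  · have : sampleLaw μ m {T | Real.exp (-(m * ε / 2)) ≤ ∏ i, f (T i)} ≤ 2⁻¹ := by
      rw [← ENNReal.ofReal_toReal (measure_ne_top _ _)]
      refine (ENNReal.ofReal_le_ofReal htail).trans_eq ?_
      rw [ENNReal.ofReal_inv_of_pos two_pos, ENNReal.ofReal_ofNat]
    refine le_trans ?_ (tsub_le_tsub_left this 1)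
    rw [ENNReal.one_sub_inv_two]
  · exact (measurableSet_le measurable_const (Finset.measurable_prod _ fun i _ =>
      hfm.comp (measurable_pi_apply i))).nullMeasurableSet

/-- Symmetrization. Passing to a measurable hull of the bad event makes its sections measurable,
so that the argument bounds outer measures and needs no measurability of the bad event. -/
theorem sampleLaw_exists_consistent_le (μ : Measure X) [IsProbabilityMeasure μ]
    {C : Set (Concept X)} (hC : ∀ h ∈ C, Measurable h) {c : Concept X} (hc : Measurable c)
    {m : ℕ} {ε : ℝ} (hε : 0 < ε) (hm : 8 ≤ m * ε) :
    sampleLaw μ m {S | ∃ h ∈ C, empErr h c S = 0 ∧ ENNReal.ofReal ε ≤ trueErr μ h c} ≤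
      2 * doubleLaw μ m (badEvent C c m ε) := by
  set E := toMeasurable (doubleLaw μ m) (badEvent C c m ε)
  have hE : MeasurableSet E := measurableSet_toMeasurable _ _
  have hsub : {S : Fin m → X | ∃ h ∈ C, empErr h c S = 0 ∧ ENNReal.ofReal ε ≤ trueErr μ h c} ⊆
      {S | 2⁻¹ ≤ sampleLaw μ m (Prod.mk S ⁻¹' E)} := by
    rintro S ⟨h, hh, hS, herr⟩
    refine (half_le_sampleLaw_le_empErr μ (hC h hh) hc hε hm herr).trans (measure_mono ?_)
    intro T hT
    refine subset_toMeasurable _ _ ⟨h, hh, ?_⟩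
    rw [gap, hS, sub_zero]
    exact hT
  have hmarkov := mul_meas_ge_le_lintegral₀ (μ := sampleLaw μ m)
    (measurable_measure_prodMk_left (ν := sampleLaw μ m) hE).aemeasurable 2⁻¹
  rw [← Measure.prod_apply hE] at hmarkov
  calc _ ≤ sampleLaw μ m {S | 2⁻¹ ≤ sampleLaw μ m (Prod.mk S ⁻¹' E)} := measure_mono hsub
    _ = 2 * (2⁻¹ * sampleLaw μ m {S | 2⁻¹ ≤ sampleLaw μ m (Prod.mk S ⁻¹' E)}) := by
      rw [← mul_assoc, ENNReal.mul_inv_cancel (by simp) (by simp), one_mul]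
    _ ≤ 2 * doubleLaw μ m E := by gcongr; exact hmarkov
    _ = _ := by rw [measure_toMeasurable]

end Symmetrization

/-! ### Random swaps -/

section Swap

/-- The sign attached to a coordinate of the double sample: `-1` if its two halves are exchanged. -/
noncomputable def swapSign (b : Bool) : ℝ := if b then -1 else 1

/-- Hoeffding's bound for a Rademacher sum, as a count of sign patterns. -/
theorem card_le_sum_swapSign_le {m : ℕ} (D : Fin m → ℝ) (hD : ∀ i, |D i| ≤ 1) {ε : ℝ}
    (hε : 0 < ε) :
    ((Finset.univ.filter fun σ : Fin m → Bool => m * (ε / 2) ≤ ∑ i, swapSign (σ i) * D i).card : ℝ)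
      ≤ 2 ^ m * Real.exp (-(m * ε ^ 2 / 8)) := by
  -- exponential moment at `ε / 2`, which optimizes `exp (m * l ^ 2 / 2 - l * m * ε / 2)`
  have hmgf : ∑ σ : Fin m → Bool, Real.exp (ε / 2 * ∑ i, swapSign (σ i) * D i) ≤
      2 ^ m * Real.exp (m * ε ^ 2 / 8) := by
    calc ∑ σ : Fin m → Bool, Real.exp (ε / 2 * ∑ i, swapSign (σ i) * D i)
        = ∏ i, ∑ b : Bool, Real.exp (ε / 2 * (swapSign b * D i)) := by
          rw [Finset.prod_univ_sum, Fintype.piFinset_univ]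
          refine Finset.sum_congr rfl fun σ _ => ?_
          rw [Finset.mul_sum, Real.exp_sum]
      _ ≤ ∏ _i : Fin m, 2 * Real.exp (ε ^ 2 / 8) := by
          refine Finset.prod_le_prod (fun i _ => by positivity) fun i _ => ?_
          have h1 : ∑ b : Bool, Real.exp (ε / 2 * (swapSign b * D i)) =
              2 * Real.cosh (ε / 2 * D i) := by
            rw [Fintype.sum_bool, Real.cosh_eq]
            simp [swapSign]
            ring
          rw [h1]
          refine mul_le_mul_of_nonneg_left ((Real.cosh_le_exp_half_sq _).trans ?_) two_pos.le
          rw [Real.exp_le_exp]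
          have : D i ^ 2 ≤ 1 := (sq_le_one_iff_abs_le_one _).2 (hD i)
          nlinarith [sq_nonneg ε]
      _ = _ := by
          rw [Finset.prod_const, Finset.card_univ, Fintype.card_fin, mul_pow, ← Real.exp_nat_mul]
          ring_nf
  have hcard : ((Finset.univ.filter fun σ : Fin m → Bool =>
      m * (ε / 2) ≤ ∑ i, swapSign (σ i) * D i).card : ℝ) * Real.exp (m * ε ^ 2 / 4) ≤
      2 ^ m * Real.exp (m * ε ^ 2 / 8) := by
    refine le_trans ?_ hmgf
    rw [← nsmul_eq_mul, ← Finset.sum_const]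
    refine (Finset.sum_le_sum fun σ hσ => ?_).trans
      (Finset.sum_le_sum_of_subset_of_nonneg (Finset.filter_subset _ _)
        fun _ _ _ => (Real.exp_pos _).le)
    rw [Real.exp_le_exp]
    have := (Finset.mem_filter.1 hσ).2
    nlinarith
  have h2 : 2 ^ m * Real.exp (m * ε ^ 2 / 8) =
      2 ^ m * Real.exp (-(m * ε ^ 2 / 8)) * Real.exp (m * ε ^ 2 / 4) := by
    rw [mul_assoc, ← Real.exp_add]
    ring_nf
  rw [h2] at hcard
  exact le_of_mul_le_mul_right hcard (Real.exp_pos _)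

/-- Exchange the `i`-th training and ghost points, for those `i` that `σ` selects. -/
def swapSample {X : Type u} {m : ℕ} (σ : Fin m → Bool) (p : (Fin m → X) × (Fin m → X)) :
    (Fin m → X) × (Fin m → X) :=
  (fun i => if σ i then p.2 i else p.1 i, fun i => if σ i then p.1 i else p.2 i)

theorem measurePreserving_swapSample {X : Type u} [MeasurableSpace X] (μ : Measure X)
    [IsProbabilityMeasure μ] {m : ℕ} (σ : Fin m → Bool) :
    MeasurePreserving (swapSample σ) (doubleLaw μ m) (doubleLaw μ m) := by
  have he := measurePreserving_arrowProdEquivProdArrow X X (Fin m) (fun _ => μ) (fun _ => μ)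
  have hpi : MeasurePreserving
      (fun (a : Fin m → X × X) i => (if σ i then Prod.swap else id) (a i))
      (Measure.pi fun _ => μ.prod μ) (Measure.pi fun _ => μ.prod μ) := by
    refine measurePreserving_pi _ _ fun i => ?_
    cases σ i
    · simpa using MeasurePreserving.id _
    · simpa using Measure.measurePreserving_swap
  have h := (he.comp hpi).comp (he.symm _)
  change MeasurePreserving _ ((Measure.pi fun _ => μ).prod (Measure.pi fun _ => μ))
    ((Measure.pi fun _ => μ).prod (Measure.pi fun _ => μ))
  convert h using 1
  ext p i <;> cases hi : σ i <;>
    simp [swapSample, hi, MeasurableEquiv.arrowProdEquivProdArrow, Equiv.arrowProdEquivProdArrow]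

theorem mul_gap_swapSample {X : Type u} {m : ℕ} (h c : Concept X) (σ : Fin m → Bool)
    (p : (Fin m → X) × (Fin m → X)) :
    m * gap h c (swapSample σ p) = ∑ i, swapSign (σ i) *
      ((if h (p.2 i) ≠ c (p.2 i) then (1 : ℝ) else 0) -
        if h (p.1 i) ≠ c (p.1 i) then (1 : ℝ) else 0) := by
  rcases Nat.eq_zero_or_pos m with rfl | hm
  · simp
  have hm' : (m : ℝ) ≠ 0 := by positivity
  rw [gap, empErr, empErr, ← sub_div, mul_div_cancel₀ _ hm', ← Finset.sum_sub_distrib]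
  refine Finset.sum_congr rfl fun i _ => ?_
  cases hi : σ i
  · simp [swapSample, swapSign, hi]
  · simp [swapSample, swapSign, hi]

end Swap

/-! ### The Vapnik-Chervonenkis bound -/

section VC

open Classical in
/-- The traces of the class on the points `z j`, as sets of indices. Indices rather than points are
used, so that repeated sample points cause no trouble. -/
noncomputable def traces {X : Type u} {ι : Type*} [Fintype ι] (C : Set (Concept X)) (z : ι → X) :
    Finset (Finset ι) :=
  Finset.univ.filter fun t => ∃ h ∈ C, t = Finset.univ.filter fun j => h (z j) = true

open Classical in
/-- A set of indices shattered by the traces maps injectively to a shattered set of points. -/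
theorem card_le_of_shatters_traces {X : Type u} {ι : Type*} [Fintype ι]
    {C : Set (Concept X)} {z : ι → X} {d : ℕ} (hd : vcDim C ≤ d) {s : Finset ι}
    (hs : (traces C z).Shatters s) : s.card ≤ d := by
  have key : ∀ t ⊆ s, ∃ h ∈ C, ∀ j ∈ s, h (z j) = true ↔ j ∈ t := by
    intro t ht
    obtain ⟨u, hu, hut⟩ := hs ht
    obtain ⟨h, hC, rfl⟩ := (Finset.mem_filter.1 hu).2
    refine ⟨h, hC, fun j hj => ?_⟩
    rw [← hut]
    simp [hj]
  have hinj : Set.InjOn z s := by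
    intro i hi j hj hij
    obtain ⟨h, -, hh⟩ := key {i} (Finset.singleton_subset_iff.2 hi)
    have := (hh j hj).1 (hij ▸ (hh i hi).2 (Finset.mem_singleton_self i))
    exact (Finset.mem_singleton.1 this).symm
  have hsh : GhostGap.Shatters C (s.image z) := by
    intro t _
    obtain ⟨h, hC, hh⟩ := key (s.filter fun j => z j ∈ t) (Finset.filter_subset _ _)
    refine ⟨h, hC, fun x hx => ?_⟩
    obtain ⟨j, hj, rfl⟩ := Finset.mem_image.1 hx
    rw [hh j hj, Finset.mem_filter]
    exact and_iff_right hj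
  have : ((s.image z).card : ℕ∞) ≤ vcDim C := le_iSup₂_of_le (s.image z) hsh le_rfl
  rw [Finset.card_image_of_injOn hinj] at this
  exact_mod_cast this.trans hd

/-- The Sauer-Shelah bound on the growth function. -/
theorem card_traces_le {X : Type u} {ι : Type*} [Fintype ι] {C : Set (Concept X)} (z : ι → X)
    {d : ℕ} (hd : vcDim C ≤ d) :
    (traces C z).card ≤ ∑ i ∈ Finset.range (d + 1), (Fintype.card ι).choose i := by
  classical
  refine (Finset.card_le_card_shatterer _).trans (Finset.card_shatterer_le_sum_vcDim.trans ?_)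
  refine Finset.sum_le_sum_of_subset fun k hk => ?_
  rw [Finset.mem_range, Nat.lt_succ_iff]
  exact (Finset.mem_Iic.1 hk).trans
    (Finset.sup_le fun s hs => card_le_of_shatters_traces hd (Finset.mem_shatterer.1 hs))

open Classical in
/-- Given the double sample, few swaps lead into the bad event: the gap depends only on the trace
of the concept, so a union bound over the traces reduces it to Hoeffding's bound. -/
theorem card_swapSample_mem_badEvent_le {X : Type u} {C : Set (Concept X)} (c : Concept X)
    {d : ℕ} (hd : vcDim C ≤ d) {m : ℕ} {ε : ℝ} (hε : 0 < ε) (p : (Fin m → X) × (Fin m → X)) :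
    ((Finset.univ.filter fun σ => swapSample σ p ∈ badEvent C c m ε).card : ℝ) ≤
      2 ^ m * ((∑ i ∈ Finset.range (d + 1), ((2 * m).choose i : ℝ)) *
        Real.exp (-(m * ε ^ 2 / 8))) := by
  let z : Fin m ⊕ Fin m → X := Sum.elim p.1 p.2
  let D : Finset (Fin m ⊕ Fin m) → Fin m → ℝ := fun t i =>
    (if decide (Sum.inr i ∈ t) ≠ c (p.2 i) then 1 else 0) -
      if decide (Sum.inl i ∈ t) ≠ c (p.1 i) then 1 else 0
  have hD : ∀ t i, |D t i| ≤ 1 := by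
    intro t i
    dsimp only [D]
    split_ifs <;> norm_num
  have hsub : (Finset.univ.filter fun σ => swapSample σ p ∈ badEvent C c m ε) ⊆
      (traces C z).biUnion fun t => Finset.univ.filter fun σ : Fin m → Bool =>
        m * (ε / 2) ≤ ∑ i, swapSign (σ i) * D t i := by
    intro σ hσ
    obtain ⟨h, hC, hgap⟩ := (Finset.mem_filter.1 hσ).2
    refine Finset.mem_biUnion.2 ⟨Finset.univ.filter fun j => h (z j) = true,
      Finset.mem_filter.2 ⟨Finset.mem_univ _, h, hC, rfl⟩,
      Finset.mem_filter.2 ⟨Finset.mem_univ _, ?_⟩⟩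
    have := mul_le_mul_of_nonneg_left hgap (Nat.cast_nonneg (α := ℝ) m)
    rw [mul_gap_swapSample] at this
    simpa [D, z] using this
  have htr : ((traces C z).card : ℝ) ≤ ∑ i ∈ Finset.range (d + 1), ((2 * m).choose i : ℝ) := by
    have := card_traces_le z hd
    rw [Fintype.card_sum, Fintype.card_fin, ← two_mul] at this
    exact_mod_cast this
  calc ((Finset.univ.filter fun σ => swapSample σ p ∈ badEvent C c m ε).card : ℝ)
      ≤ ∑ t ∈ traces C z, ((Finset.univ.filter fun σ : Fin m → Bool =>
          m * (ε / 2) ≤ ∑ i, swapSign (σ i) * D t i).card : ℝ) := by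
        exact_mod_cast (Finset.card_le_card hsub).trans Finset.card_biUnion_le
    _ ≤ ∑ _t ∈ traces C z, 2 ^ m * Real.exp (-(m * ε ^ 2 / 8)) :=
        Finset.sum_le_sum fun t _ => card_le_sum_swapSign_le _ (hD t) hε
    _ = (traces C z).card * (2 ^ m * Real.exp (-(m * ε ^ 2 / 8))) := by
        rw [Finset.sum_const, nsmul_eq_mul]
    _ ≤ (∑ i ∈ Finset.range (d + 1), ((2 * m).choose i : ℝ)) *
          (2 ^ m * Real.exp (-(m * ε ^ 2 / 8))) := by gcongr
    _ = _ := by ring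

/-- The double law is invariant under every swap, so the probability of the bad event is at most
the largest proportion of swaps leading into it. -/
theorem doubleLaw_badEvent_le {X : Type u} [MeasurableSpace X] (μ : Measure X)
    [IsProbabilityMeasure μ] {C : Set (Concept X)} {c : Concept X} {d : ℕ} (hd : vcDim C ≤ d)
    {m : ℕ} {ε : ℝ} (hε : 0 < ε) (hE : NullMeasurableSet (badEvent C c m ε) (doubleLaw μ m)) :
    doubleLaw μ m (badEvent C c m ε) ≤
      ENNReal.ofReal ((∑ i ∈ Finset.range (d + 1), ((2 * m).choose i : ℝ)) *
        Real.exp (-(m * ε ^ 2 / 8))) := by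
  classical
  set K : ℝ := (∑ i ∈ Finset.range (d + 1), ((2 * m).choose i : ℝ)) * Real.exp (-(m * ε ^ 2 / 8))
  set E := badEvent C c m ε
  have hswap : ∀ σ : Fin m → Bool, NullMeasurableSet (swapSample σ ⁻¹' E) (doubleLaw μ m) :=
    fun σ => hE.preimage (measurePreserving_swapSample μ σ).quasiMeasurePreserving
  have hmain : 2 ^ m * doubleLaw μ m E ≤ 2 ^ m * ENNReal.ofReal K := by
    calc 2 ^ m * doubleLaw μ m E = ∑ σ : Fin m → Bool, doubleLaw μ m (swapSample σ ⁻¹' E) := by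
          rw [Finset.sum_congr rfl fun σ _ =>
            (measurePreserving_swapSample μ σ).measure_preimage hE]
          simp
      _ = ∫⁻ p, ∑ σ : Fin m → Bool,
            (swapSample σ ⁻¹' E).indicator (fun _ => 1) p ∂(doubleLaw μ m) := by
          rw [lintegral_finsetSum' _ fun σ _ => aemeasurable_const.indicator₀ (hswap σ)]
          exact Finset.sum_congr rfl fun σ _ => (lintegral_indicator_one₀ (hswap σ)).symm
      _ ≤ ∫⁻ _, 2 ^ m * ENNReal.ofReal K ∂(doubleLaw μ m) := by
          refine lintegral_mono fun p => ?_
          have h1 : ∑ σ : Fin m → Bool, (swapSample σ ⁻¹' E).indicator (fun _ => (1 : ENNReal)) p =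
              ((Finset.univ.filter fun σ => swapSample σ p ∈ E).card : ENNReal) := by
            simp [Set.indicator_apply]
          have h2 := ENNReal.ofReal_le_ofReal (card_swapSample_mem_badEvent_le c hd hε p)
          rw [ENNReal.ofReal_natCast, ENNReal.ofReal_mul (by positivity),
            ENNReal.ofReal_pow two_pos.le, ENNReal.ofReal_ofNat] at h2
          exact h1.trans_le h2
      _ = _ := by simp
  exact (ENNReal.mul_le_mul_iff_right (by simp) (by simp)).1 hmain

end VC

/-! ### Consistent learners -/

section Learners

variable {X : Type u} [MeasurableSpace X]

theorem tendsto_vcBound_zero (d : ℕ) {ε : ℝ} (hε : 0 < ε) :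
    Filter.Tendsto (fun m : ℕ => 2 * ((∑ i ∈ Finset.range (d + 1), ((2 * m).choose i : ℝ)) *
      Real.exp (-(m * ε ^ 2 / 8)))) Filter.atTop (nhds 0) := by
  have hr : Real.exp (-(ε ^ 2 / 8)) < 1 := by
    rw [Real.exp_lt_one_iff]
    have : 0 < ε ^ 2 := by positivity
    linarith
  have hterm : ∀ i ∈ Finset.range (d + 1), Filter.Tendsto
      (fun m : ℕ => 2 ^ i * ((m : ℝ) ^ i * Real.exp (-(ε ^ 2 / 8)) ^ m)) Filter.atTop (nhds 0) :=
    fun i _ => by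
      simpa using (tendsto_pow_const_mul_const_pow_of_lt_one i (Real.exp_pos _).le hr).const_mul
        (2 ^ i : ℝ)
  have hsum := (tendsto_finsetSum _ hterm).const_mul 2
  rw [Finset.sum_const_zero, mul_zero] at hsum
  refine squeeze_zero (fun m => by positivity) (fun m => ?_) hsum
  rw [Finset.sum_mul]
  refine mul_le_mul_of_nonneg_left (Finset.sum_le_sum fun i _ => ?_) two_pos.le
  have h1 : ((2 * m).choose i : ℝ) ≤ 2 ^ i * (m : ℝ) ^ i := by
    rw [← mul_pow]
    exact_mod_cast Nat.choose_le_pow (2 * m) i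
  rw [← mul_assoc, ← Real.exp_nat_mul]
  refine (mul_le_mul_of_nonneg_right h1 (Real.exp_pos _).le).trans_eq ?_
  ring_nf

/-- Symmetrization and the VC bound control the consistent concepts of large error uniformly, hence
whatever a consistent learner outputs. -/
theorem IsConsistentLearner.isPACLearner {C : Set (Concept X)} (hC : ∀ h ∈ C, Measurable h)
    (hWB : WBMeas C) {d : ℕ} (hd : vcDim C ≤ d) {A : Learner X} (hA : IsConsistentLearner C A) :
    IsPACLearner C A := by
  have hN : ∀ ε δ : ℝ, ∃ N : ℕ, 0 < ε → 0 < δ → ∀ m ≥ N, 8 ≤ m * ε ∧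
      2 * ((∑ i ∈ Finset.range (d + 1), ((2 * m).choose i : ℝ)) *
        Real.exp (-(m * ε ^ 2 / 8))) ≤ δ := by
    intro ε δ
    by_cases hε : 0 < ε
    · by_cases hδ : 0 < δ
      · have h1 := (tendsto_natCast_atTop_atTop (R := ℝ)).atTop_mul_const hε
        obtain ⟨N, hN⟩ := Filter.eventually_atTop.1 ((h1.eventually_ge_atTop 8).and
          ((tendsto_vcBound_zero d hε).eventually_le_const hδ))
        exact ⟨N, fun _ _ => hN⟩
      · exact ⟨0, fun _ h => absurd h hδ⟩
    · exact ⟨0, fun h => absurd h hε⟩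
  choose N hN using hN
  refine ⟨N, fun ε δ hε hδ m hm μ _ c hc => ?_⟩
  obtain ⟨hmε, hbound⟩ := hN ε δ hε hδ m hm
  calc sampleLaw μ m {S | ENNReal.ofReal ε < trueErr μ (A m (labelled c S)) c}
      ≤ sampleLaw μ m {S | ∃ h ∈ C, empErr h c S = 0 ∧ ENNReal.ofReal ε ≤ trueErr μ h c} := by
        refine measure_mono fun S hS => ⟨_, (hA c hc m S).1, ?_, le_of_lt hS⟩
        simp [empErr, (hA c hc m S).2]
    _ ≤ 2 * doubleLaw μ m (badEvent C c m ε) :=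
        sampleLaw_exists_consistent_le μ hC (hC c hc) hε hmε
    _ ≤ 2 * ENNReal.ofReal ((∑ i ∈ Finset.range (d + 1), ((2 * m).choose i : ℝ)) *
          Real.exp (-(m * ε ^ 2 / 8))) := by
        gcongr
        exact doubleLaw_badEvent_le μ hd hε (hWB μ c (hC c hc) m ε hε)
    _ ≤ ENNReal.ofReal δ := by
        rw [← ENNReal.ofReal_ofNat, ← ENNReal.ofReal_mul two_pos.le]
        exact ENNReal.ofReal_le_ofReal hbound

theorem exists_isConsistentLearner {C : Set (Concept X)} (hC : ∀ h ∈ C, Measurable h) :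
    ∃ A : Learner X, (∀ m S, Measurable (A m S)) ∧ IsConsistentLearner C A := by
  have H : ∀ (m : ℕ) (S : Fin m → X × Bool), ∃ g : Concept X, Measurable g ∧
      ((∃ h ∈ C, ∀ i, h (S i).1 = (S i).2) → g ∈ C ∧ ∀ i, g (S i).1 = (S i).2) := by
    intro m S
    by_cases h : ∃ h ∈ C, ∀ i, h (S i).1 = (S i).2
    · obtain ⟨g, hg, hgS⟩ := h
      exact ⟨g, hC g hg, fun _ => ⟨hg, hgS⟩⟩
    · exact ⟨fun _ => false, measurable_const, fun h' => absurd h' h⟩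
  choose A hA hAC using H
  exact ⟨A, hA, fun c hc m S => hAC m (labelled c S) ⟨c, hc, fun _ => rfl⟩⟩

end Learners

/-! ### The Borel condition implies measurability of the bad events -/

theorem finite_range_gap {X : Type u} (c : Concept X) {m : ℕ}
    (p : (Fin m → X) × (Fin m → X)) : (Set.range fun h : Concept X => gap h c p).Finite := by
  let F : (Fin m → Bool) × (Fin m → Bool) → ℝ := fun q =>
    (∑ i, if q.2 i ≠ c (p.2 i) then (1 : ℝ) else 0) / m -
      (∑ i, if q.1 i ≠ c (p.1 i) then (1 : ℝ) else 0) / m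
  refine (Set.finite_range F).subset ?_
  rintro _ ⟨h, rfl⟩
  exact ⟨(h ∘ p.1, h ∘ p.2), rfl⟩

/-- For a nonempty class the supremum of the gap is attained, so the bad event is one of its
superlevel sets. -/
theorem mem_badEvent_iff_le_supGap {X : Type u} {C : Set (Concept X)} (hC : C.Nonempty)
    (c : Concept X) {m : ℕ} {ε : ℝ} (p : (Fin m → X) × (Fin m → X)) :
    p ∈ badEvent C c m ε ↔ ε / 2 ≤ supGap C c m p := by
  have : Nonempty C := hC.to_subtype
  have hfin : (Set.range fun h : C => gap h.1 c p).Finite :=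
    (finite_range_gap c p).subset fun _ ⟨h, hh⟩ => ⟨h.1, hh⟩
  constructor
  · rintro ⟨h, hh, hgap⟩
    exact hgap.trans (le_ciSup hfin.bddAbove (⟨h, hh⟩ : C))
  · intro hp
    obtain ⟨h, hh⟩ := (Set.range_nonempty _).csSup_mem hfin
    exact ⟨h.1, h.2, hp.trans_eq hh.symm⟩

theorem KWMeas.wbMeas {X : Type u} [MeasurableSpace X] {C : Set (Concept X)} (hC : KWMeas C) :
    WBMeas C := by
  intro μ _ c hc m ε _
  rcases C.eq_empty_or_nonempty with rfl | hne
  · have : badEvent (∅ : Set (Concept X)) c m ε = ∅ := by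
      ext
      simp [badEvent]
    rw [this]
    exact nullMeasurableSet_empty
  · have : badEvent C c m ε = {p | ε / 2 ≤ supGap C c m p} :=
      Set.ext fun p => mem_badEvent_iff_le_supGap hne c p
    rw [this]
    exact (measurableSet_le measurable_const (hC c hc m)).nullMeasurableSet

/-! ### Unit intervals with restricted left endpoints -/

section UnitIntervals

/-- The class of the closed unit intervals whose left endpoint belongs to `A`. -/
def unitIntervals (A : Set ℝ) : Set (Concept ℝ) :=
  (fun a x => decide (a ≤ x ∧ x ≤ a + 1)) '' A

theorem measurable_of_mem_unitIntervals {A : Set ℝ} : ∀ h ∈ unitIntervals A, Measurable h := by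
  rintro _ ⟨a, -, rfl⟩
  refine measurable_to_bool ?_
  convert measurableSet_Icc (a := a) (b := a + 1) using 1
  ext x
  simp

theorem vcDim_unitIntervals_le (A : Set ℝ) : vcDim (unitIntervals A) ≤ 2 := by
  refine iSup₂_le fun s hs => ?_
  by_contra! hcard
  have hcard : 2 < s.card := by exact_mod_cast hcard
  have hne : s.Nonempty := Finset.card_pos.1 (by omega)
  obtain ⟨y, hy⟩ : ((s.erase (s.min' hne)).erase (s.max' hne)).Nonempty := by
    rw [← Finset.card_pos]
    have h1 := Finset.pred_card_le_card_erase (s := s) (a := s.min' hne)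
    have h2 := Finset.pred_card_le_card_erase (s := s.erase (s.min' hne)) (a := s.max' hne)
    omega
  simp only [Finset.mem_erase] at hy
  obtain ⟨hymax, hymin, hys⟩ := hy
  -- an interval containing the least and the greatest point of `s` contains those in between
  obtain ⟨_, ⟨a, -, rfl⟩, hh⟩ := hs {s.min' hne, s.max' hne} (by
    intro x hx
    rcases Finset.mem_insert.1 hx with rfl | hx
    · exact s.min'_mem hne
    · exact Finset.mem_singleton.1 hx ▸ s.max'_mem hne)
  have h1 := (hh _ (s.min'_mem hne)).2 (by simp)
  have h2 := (hh _ (s.max'_mem hne)).2 (by simp)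
  have h3 := (hh y hys).1 (by
    simp only [decide_eq_true_eq] at h1 h2 ⊢
    exact ⟨h1.1.trans (s.min'_le y hys), (s.le_max' y hys).trans h2.2⟩)
  simp [hymax, hymin] at h3

theorem gap_congr {X : Type u} {m : ℕ} {h h' c : Concept X} {p : (Fin m → X) × (Fin m → X)}
    (H : ∀ j, h (Sum.elim p.1 p.2 j) = h' (Sum.elim p.1 p.2 j)) : gap h c p = gap h' c p := by
  have h1 : ∀ i, h (p.1 i) = h' (p.1 i) := fun i => H (.inl i)
  have h2 : ∀ i, h (p.2 i) = h' (p.2 i) := fun i => H (.inr i)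
  simp only [gap, empErr, h1, h2]

/-- Unless some two of the finitely many points `z j` are exactly the two endpoints of `[a, a + 1]`,
a unit interval with rational endpoints has the same trace on them: the interval can be shifted
away from whichever endpoint is not among the points. -/
theorem exists_rat_unitInterval_eq {ι : Type*} [Finite ι] (z : ι → ℝ) (a : ℝ)
    (hz : ¬ ((∃ i, z i = a) ∧ ∃ j, z j = a + 1)) :
    ∃ q : ℚ, ∀ j, decide ((q : ℝ) ≤ z j ∧ z j ≤ q + 1) = decide (a ≤ z j ∧ z j ≤ a + 1) := by
  rw [not_and_or] at hz
  push Not at hz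
  rcases hz with hz | hz
  · have H : ∀ᶠ q in nhdsWithin a (Set.Ioi a),
        ∀ j, decide (q ≤ z j ∧ z j ≤ q + 1) = decide (a ≤ z j ∧ z j ≤ a + 1) := by
      rw [Filter.eventually_all]
      intro j
      have hlt : ∀ᶠ q in nhdsWithin a (Set.Ioi a), a < q := self_mem_nhdsWithin
      have hu : ∀ b, a < b → ∀ᶠ q in nhdsWithin a (Set.Ioi a), q < b := fun b hb =>
        nhdsWithin_le_nhds (Iio_mem_nhds hb)
      rcases (hz j).lt_or_gt with h | h
      · filter_upwards [hlt] with q hq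
        rw [decide_eq_decide]
        constructor <;> intro ⟨h1, h2⟩ <;> exfalso <;> linarith
      · rcases le_or_gt (z j) (a + 1) with h' | h'
        · filter_upwards [hlt, hu _ h] with q hq hq'
          rw [decide_eq_decide]
          constructor <;> intro ⟨h1, h2⟩ <;> constructor <;> linarith
        · filter_upwards [hlt, hu (z j - 1) (by linarith)] with q hq hq'
          rw [decide_eq_decide]
          constructor <;> intro ⟨h1, h2⟩ <;> exfalso <;> linarith
    obtain ⟨b, hb, hab⟩ := mem_nhdsGT_iff_exists_Ioo_subset.1 H
    obtain ⟨q, hq1, hq2⟩ := exists_rat_btwn (Set.mem_Ioi.1 hb)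
    exact ⟨q, hab ⟨hq1, hq2⟩⟩
  · have H : ∀ᶠ q in nhdsWithin a (Set.Iio a),
        ∀ j, decide (q ≤ z j ∧ z j ≤ q + 1) = decide (a ≤ z j ∧ z j ≤ a + 1) := by
      rw [Filter.eventually_all]
      intro j
      have hlt : ∀ᶠ q in nhdsWithin a (Set.Iio a), q < a := self_mem_nhdsWithin
      have hl : ∀ b, b < a → ∀ᶠ q in nhdsWithin a (Set.Iio a), b < q := fun b hb =>
        nhdsWithin_le_nhds (Ioi_mem_nhds hb)
      rcases (hz j).lt_or_gt with h | h
      · rcases le_or_gt a (z j) with h' | h'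
        · filter_upwards [hlt, hl (z j - 1) (by linarith)] with q hq hq'
          rw [decide_eq_decide]
          constructor <;> intro ⟨h1, h2⟩ <;> constructor <;> linarith
        · filter_upwards [hlt, hl _ h'] with q hq hq'
          rw [decide_eq_decide]
          constructor <;> intro ⟨h1, h2⟩ <;> exfalso <;> linarith
      · filter_upwards [hlt] with q hq
        rw [decide_eq_decide]
        constructor <;> intro ⟨h1, h2⟩ <;> exfalso <;> linarith
    obtain ⟨b, hb, hab⟩ := mem_nhdsLT_iff_exists_Ioo_subset.1 H
    obtain ⟨q, hq1, hq2⟩ := exists_rat_btwn (Set.mem_Iio.1 hb)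
    exact ⟨q, hab ⟨hq1, hq2⟩⟩

theorem countable_setOf_measure_singleton_ne_zero (μ : Measure ℝ) [SigmaFinite μ] :
    {x : ℝ | μ {x} ≠ 0}.Countable := by
  have := Measure.countable_meas_level_set_pos (μ := μ) (measurable_id (α := ℝ))
  simpa [pos_iff_ne_zero] using this

/-- Two points of an independent sample differ by exactly `1` only at atoms, almost surely. -/
theorem doubleLaw_setOf_eq_add_one (μ : Measure ℝ) [IsProbabilityMeasure μ] (m : ℕ)
    (i j : Fin m ⊕ Fin m) :
    doubleLaw μ m {p | Sum.elim p.1 p.2 j = Sum.elim p.1 p.2 i + 1 ∧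
      μ {Sum.elim p.1 p.2 i} = 0} = 0 := by
  rcases eq_or_ne j i with rfl | hij
  · convert measure_empty (μ := doubleLaw μ m)
    ext p
    simp
  have hat : MeasurableSet {x : ℝ | μ {x} = 0} := by
    simpa [Set.compl_def] using
      (countable_setOf_measure_singleton_ne_zero μ).measurableSet.compl
  let N : Set (ℝ × ℝ) := {q | q.1 = q.2 + 1 ∧ μ {q.2} = 0}
  have hN : MeasurableSet N :=
    (measurableSet_eq_fun measurable_fst (measurable_snd.add_const 1)).inter (measurable_snd hat)
  have hN0 : μ.prod μ N = 0 := by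
    rw [Measure.measure_prod_null hN]
    refine Filter.Eventually.of_forall fun y => ?_
    by_cases hy : μ {y - 1} = 0
    · refine measure_mono_null (fun x hx => ?_) hy
      have : y = x + 1 := hx.1
      simp [this]
    · have hempty : Prod.mk y ⁻¹' N = ∅ := by
        rw [Set.eq_empty_iff_forall_notMem]
        rintro x ⟨h1, h2⟩
        have h1 : y = x + 1 := h1
        have h2 : μ {x} = 0 := h2
        exact hy (by simpa [h1] using h2)
      simp [hempty]
  have hpair : MeasurePreserving (fun z : Fin m ⊕ Fin m → ℝ => (z j, z i))
      (Measure.pi fun _ => μ) (μ.prod μ) := by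
    refine ⟨by fun_prop, ?_⟩
    have hind : ProbabilityTheory.IndepFun (fun z : Fin m ⊕ Fin m → ℝ => z j) (fun z => z i)
        (Measure.pi fun _ => μ) :=
      (ProbabilityTheory.iIndepFun_pi (μ := fun _ : Fin m ⊕ Fin m => μ) (X := fun _ x => x)
        fun _ => aemeasurable_id).indepFun hij
    rw [ProbabilityTheory.indepFun_iff_map_prod_eq_prod_map_map
      (measurable_pi_apply j).aemeasurable
      (measurable_pi_apply i).aemeasurable] at hind
    rw [hind]
    congr 1
    · exact (measurePreserving_eval (fun _ : Fin m ⊕ Fin m => μ) j).map_eq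
    · exact (measurePreserving_eval (fun _ : Fin m ⊕ Fin m => μ) i).map_eq
  have hsum := measurePreserving_sumPiEquivProdPi_symm fun _ : Fin m ⊕ Fin m => μ
  have := (hpair.comp hsum).measure_preimage hN.nullMeasurableSet
  rw [hN0] at this
  have hset : {p : (Fin m → ℝ) × (Fin m → ℝ) | Sum.elim p.1 p.2 j = Sum.elim p.1 p.2 i + 1 ∧
      μ {Sum.elim p.1 p.2 i} = 0} = ((fun z : Fin m ⊕ Fin m → ℝ => (z j, z i)) ∘
        (MeasurableEquiv.sumPiEquivProdPi fun _ : Fin m ⊕ Fin m => ℝ).symm) ⁻¹' N := by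
    ext p
    rcases i with i | i <;> rcases j with j | j <;> rfl
  rw [hset]
  exact this

/-- Countably many of the intervals, those starting at a rational or at an atom, produce the whole
bad event up to a null set. Nothing is assumed about the regularity of `A`. -/
theorem wbMeas_unitIntervals {A : Set ℝ} (hA : Set.range ((↑) : ℚ → ℝ) ⊆ A) :
    WBMeas (unitIntervals A) := by
  intro μ _ c hc m ε _
  set A' : Set ℝ := Set.range ((↑) : ℚ → ℝ) ∪ {a ∈ A | μ {a} ≠ 0}
  have hA' : A'.Countable := (Set.countable_range _).union
    ((countable_setOf_measure_singleton_ne_zero μ).mono fun a ha => ha.2)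
  have hAA : A' ⊆ A := Set.union_subset hA fun a ha => ha.1
  have hmeas : MeasurableSet (badEvent (unitIntervals A') c m ε) := by
    have : badEvent (unitIntervals A') c m ε =
        ⋃ h ∈ unitIntervals A', {p | ε / 2 ≤ gap h c p} := by
      ext p
      simp [badEvent]
    rw [this]
    exact .biUnion (hA'.image _) fun h hh =>
      measurableSet_le measurable_const (measurable_gap (measurable_of_mem_unitIntervals h hh) hc)
  refine hmeas.nullMeasurableSet.congr (ae_eq_set.2 ⟨?_, ?_⟩)
  · convert measure_empty (μ := doubleLaw μ m)
    refine Set.sdiff_eq_empty.2 ?_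
    rintro p ⟨h, hh, hgap⟩
    exact ⟨h, Set.image_mono hAA hh, hgap⟩
  · refine measure_mono_null (t := ⋃ i, ⋃ j, {p | Sum.elim p.1 p.2 j = Sum.elim p.1 p.2 i + 1 ∧
      μ {Sum.elim p.1 p.2 i} = 0}) ?_ (measure_iUnion_null fun i => measure_iUnion_null fun j =>
        doubleLaw_setOf_eq_add_one μ m i j)
    rintro p ⟨⟨_, ⟨a, ha, rfl⟩, hgap⟩, hnot⟩
    have ha0 : μ {a} = 0 := by
      by_contra h0
      exact hnot ⟨_, ⟨a, Or.inr ⟨ha, h0⟩, rfl⟩, hgap⟩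
    by_cases hz : (∃ i, Sum.elim p.1 p.2 i = a) ∧ ∃ j, Sum.elim p.1 p.2 j = a + 1
    · obtain ⟨⟨i, hi⟩, j, hj⟩ := hz
      simp only [Set.mem_iUnion]
      exact ⟨i, j, by rw [hi, hj], by rw [hi, ha0]⟩
    · obtain ⟨q, hq⟩ := exists_rat_unitInterval_eq _ a hz
      exact absurd ⟨_, ⟨q, Or.inl ⟨q, rfl⟩, rfl⟩, hgap.trans_eq (gap_congr hq).symm⟩ hnot

/-- For one training point `t + 1`, one ghost point `t ∈ [-1, 0)` and the target `[0, ∞)`, the bad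
event requires an interval that contains both points, hence starts at `t`. -/
theorem measurableSet_inter_of_kwMeas_unitIntervals {A : Set ℝ} (hne : A.Nonempty)
    (hA : KWMeas (unitIntervals A)) : MeasurableSet (A ∩ Set.Ico (-1) 0) := by
  let c : Concept ℝ := fun x => decide (0 ≤ x)
  have hc : Measurable c := by
    refine measurable_to_bool ?_
    convert measurableSet_Ici (a := (0 : ℝ)) using 1
    ext x
    simp [c]
  let g : ℝ → (Fin 1 → ℝ) × (Fin 1 → ℝ) := fun t => (fun _ => t + 1, fun _ => t)
  have hg : Measurable g := (measurable_pi_lambda _ fun _ => measurable_id.add_const 1).prodMk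
    (measurable_pi_lambda _ fun _ => measurable_id)
  have hset : A ∩ Set.Ico (-1) 0 =
      g ⁻¹' {p | 2 / 2 ≤ supGap (unitIntervals A) c 1 p} ∩ Set.Ico (-1) 0 := by
    ext t
    refine and_congr_left fun ht => ?_
    rw [Set.mem_preimage, Set.mem_ofPred_eq,
      ← mem_badEvent_iff_le_supGap (C := unitIntervals A) (hne.image _)]
    have ht0 : ¬ (0 : ℝ) ≤ t := not_le.2 ht.2
    have ht1 : (0 : ℝ) ≤ t + 1 := by linarith [ht.1]
    have hgap : ∀ a : ℝ, 2 / 2 ≤ gap (fun x => decide (a ≤ x ∧ x ≤ a + 1)) c (g t) ↔ a = t := by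
      intro a
      simp only [gap, empErr, g, c, ht0, ht1, Fin.sum_univ_one, Nat.cast_one, div_one,
        decide_true, decide_false, ne_eq, decide_eq_true_eq, decide_eq_false_iff_not, not_not]
      constructor
      · intro h
        split_ifs at h with h1 h2 h2
        · linarith [h1.1, h2.2]
        all_goals norm_num at h
      · rintro rfl
        norm_num
    constructor
    · exact fun ha => ⟨_, ⟨t, ha, rfl⟩, (hgap t).2 rfl⟩
    · rintro ⟨_, ⟨a, ha, rfl⟩, h⟩
      exact (hgap a).1 h ▸ ha
  rw [hset]
  exact (hg (measurableSet_le measurable_const (hA c hc 1))).inter measurableSet_Ico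

/-- There are only continuum many Borel sets. -/
theorem exists_subset_Ico_not_measurableSet : ∃ B ⊆ Set.Ico (-1 : ℝ) 0, ¬ MeasurableSet B := by
  by_contra! hcon
  have h1 : Cardinal.mk {t : Set ℝ | MeasurableSet t} ≤ Cardinal.continuum := by
    have := MeasurableSpace.cardinal_measurableSet_le_continuum
      ((MeasurableSpace.countable_countableGeneratingSet (α := ℝ)).le_aleph0.trans
        Cardinal.aleph0_le_continuum)
    rwa [MeasurableSpace.generateFrom_countableGeneratingSet] at this
  have h2 : Cardinal.mk (Set.powerset (Set.Ico (-1 : ℝ) 0)) ≤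
      Cardinal.mk {t : Set ℝ | MeasurableSet t} := Cardinal.mk_le_mk_of_subset hcon
  rw [Cardinal.mk_powerset, Cardinal.mk_Ico_real (by norm_num)] at h2
  exact absurd (h2.trans h1) (Cardinal.cantor _).not_ge

theorem exists_wbMeas_not_kwMeas : ∃ C : Set (Concept ℝ),
    (∀ h ∈ C, Measurable h) ∧ vcDim C < ⊤ ∧ WBMeas C ∧ ¬ KWMeas C := by
  obtain ⟨B, hB, hBm⟩ := exists_subset_Ico_not_measurableSet
  have hQ : (Set.range ((↑) : ℚ → ℝ)).Countable := Set.countable_range _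
  refine ⟨unitIntervals (B ∪ Set.range ((↑) : ℚ → ℝ)), measurable_of_mem_unitIntervals,
    (vcDim_unitIntervals_le _).trans_lt (by decide), wbMeas_unitIntervals Set.subset_union_right,
    fun hKW => hBm ?_⟩
  have h := measurableSet_inter_of_kwMeas_unitIntervals ⟨_, Or.inr ⟨0, rfl⟩⟩ hKW
  -- adding or removing rationals does not affect measurability
  have hBeq : B = ((B ∪ Set.range ((↑) : ℚ → ℝ)) ∩ Set.Ico (-1) 0) \ Set.range ((↑) : ℚ → ℝ) ∪
      B ∩ Set.range ((↑) : ℚ → ℝ) := by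
    ext x
    have := @hB x
    simp only [Set.mem_union, Set.mem_inter_iff, Set.mem_sdiff]
    tauto
  rw [hBeq]
  exact (h.diff hQ.measurableSet).union (hQ.mono Set.inter_subset_right).measurableSet

end UnitIntervals

end GhostGap

open GhostGap in
theorem corollary6 {X : Type u} [TopologicalSpace X] [PolishSpace X] [MeasurableSpace X]
    [BorelSpace X] :
    -- the symmetrization route from finite VC dimension to PAC learnability, under `WBMeas` only
    (∀ C : Set (Concept X), (∀ h ∈ C, Measurable h) → WBMeas C → ∀ d : ℕ, vcDim C ≤ d →
      -- symmetrization
      (∀ (μ : Measure X) [IsProbabilityMeasure μ], ∀ c ∈ C, ∀ (m : ℕ) (ε : ℝ), 0 < ε →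
        8 ≤ m * ε →
        sampleLaw μ m {S | ∃ h ∈ C, empErr h c S = 0 ∧ ENNReal.ofReal ε ≤ trueErr μ h c} ≤
          2 * doubleLaw μ m (badEvent C c m ε)) ∧
      -- the bad event is measurable in the completion, and its probability obeys the VC bound
      (∀ (μ : Measure X) [IsProbabilityMeasure μ], ∀ c ∈ C, ∀ (m : ℕ) (ε : ℝ), 0 < ε →
        NullMeasurableSet (badEvent C c m ε) (doubleLaw μ m) ∧
        doubleLaw μ m (badEvent C c m ε) ≤
          ENNReal.ofReal ((∑ i ∈ Finset.range (d + 1), ((2 * m).choose i : ℝ)) *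
            Real.exp (-(m * ε ^ 2 / 8)))) ∧
      -- every consistent learner is a PAC learner, and the class is PAC learnable
      (∀ A : Learner X, IsConsistentLearner C A → IsPACLearner C A) ∧
      PACLearnable C) ∧
    -- the Borel condition is stronger
    (∀ C : Set (Concept X), (KW C → KWMeas C) ∧ (KWMeas C → WBMeas C)) ∧
    -- strictly so, already for classes in the scope of the route
    (∃ C : Set (Concept ℝ), (∀ h ∈ C, Measurable h) ∧ vcDim C < ⊤ ∧ WBMeas C ∧ ¬ KWMeas C) ∧
    -- Borel-parameterized classes and everything generated from them
    (∀ C : Set (Concept X), BorelGenerated.{u, w} C → (∀ h ∈ C, Measurable h) ∧ WBMeas C) := by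

  refine ⟨fun C hC hWB d hd => ⟨?_, ?_, fun A hA => hA.isPACLearner hC hWB hd, ?_⟩,
    fun C => ⟨fun h c _ m => h c m, KWMeas.wbMeas⟩, exists_wbMeas_not_kwMeas,
    fun C hC => ⟨hC.isBorelParam.measurable, hC.isBorelParam.wbMeas⟩⟩
  · intro μ _ c hc m ε hε hm
    exact sampleLaw_exists_consistent_le μ hC (hC c hc) hε hm
  · intro μ _ c hc m ε hε
    have hE := hWB μ c (hC c hc) m ε hε
    exact ⟨hE, doubleLaw_badEvent_le μ hd hε hE⟩
  · obtain ⟨A, hAm, hA⟩ := exists_isConsistentLearner hC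
    exact ⟨A, hAm, hA.isPACLearner hC hWB hd⟩
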